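/- A system $(X,T)$ is a compact metric space $X$ with a homeomorphism $T\colon X\to X$. Let $\operatorname{Aut}(X,T)$ be the group (under composition) of homeomorphisms $\varphi\colon X\to X$ with $\varphi\circ T=T\circ\varphi$, and let $\operatorname{Aut}^{(\infty)}(X,T)=\bigcup_{n\ge 1}\operatorname{Aut}(X,T^n)$ be the stabilized automorphism group. Systems $(X,T)$ and $(Y,S)$ are conjugate if there is a homeomorphism $\pi\colon X\to Y$ with $\pi\circ T=S\circ\pi$. An odometer is a system conjugate to $(\mathbb{Z}_s,\,x\mapsto x+1)$ for some unbounded sequence $s=(s_n)_{n\ge 0}$ of positive integers with $s_n\mid s_{n+1}$ for all $n$, where $\mathbb{Z}_s=\varprojlim \mathbb{Z}/s_n\mathbb{Z}$ carries the inverse limit topology of the discrete spaces $\mathbb{Z}/s_n\mathbb{Z}$. Let $(X,T)$ and $(Y,S)$ be odometers. If $\operatorname{Aut}^{(\infty)}(X,T)$ and $\operatorname{Aut}^{(\infty)}(Y,S)$ are isomorphic as groups, then $(X,T)$ and $(Y,S)$ are conjugate. -/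

import Mathlib

/-- The automorphism group `Aut(X, T)` of a system: all homeomorphisms of `X` commuting with `T`.
The group law on `X ≃ₜ X` is composition. -/
def autGroup {X : Type*} [TopologicalSpace X] (T : X ≃ₜ X) : Subgroup (X ≃ₜ X) where
  carrier := {φ | φ * T = T * φ}
  mul_mem' {a b} ha hb := Commute.mul_left (show Commute a T from ha) (show Commute b T from hb)
  one_mem' := Commute.one_left T
  inv_mem' {a} ha := Commute.inv_left (show Commute a T from ha)

/-- The stabilized automorphism group `Aut^(∞)(X, T) = ⋃_{n ≥ 1} Aut(X, T ^ n)`, as a subgroup of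
the group of all homeomorphisms of `X`. -/
def stabilizedAutGroup {X : Type*} [TopologicalSpace X] (T : X ≃ₜ X) : Subgroup (X ≃ₜ X) where
  carrier := {φ | ∃ n : ℕ, 1 ≤ n ∧ φ ∈ autGroup (T ^ n)}
  mul_mem' := by
    rintro a b ⟨n, hn, ha⟩ ⟨m, hm, hb⟩
    refine ⟨n * m, Nat.mul_pos hn hm, (autGroup (T ^ (n * m))).mul_mem ?_ ?_⟩
    · rw [pow_mul]
      exact Commute.pow_right (show Commute a (T ^ n) from ha) m
    · rw [mul_comm n m, pow_mul]
      exact Commute.pow_right (show Commute b (T ^ m) from hb) n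
  one_mem' := ⟨1, le_rfl, (autGroup (T ^ 1)).one_mem⟩
  inv_mem' := by
    rintro a ⟨n, hn, ha⟩
    exact ⟨n, hn, (autGroup (T ^ n)).inv_mem ha⟩

/-- Two systems `(X, T)` and `(Y, S)` are (topologically) conjugate. -/
def AreConjugate {X Y : Type*} [TopologicalSpace X] [TopologicalSpace Y]
    (T : X ≃ₜ X) (S : Y ≃ₜ Y) : Prop :=
  ∃ π : X ≃ₜ Y, ∀ x, π (T x) = S (π x)

/-- A scale: positive integers `s 0 ∣ s 1 ∣ s 2 ∣ ⋯` that are unbounded. -/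
structure IsScale (s : ℕ → ℕ) : Prop where
  pos : ∀ n, 0 < s n
  dvd : ∀ n, s n ∣ s (n + 1)
  unbounded : ∀ B, ∃ n, B < s n

/-- The inverse limit of `ℤ/s₀ ← ℤ/s₁ ← ℤ/s₂ ← ⋯` along the reduction maps, as a subring of the
product `∏ n, ℤ/sₙ`. It carries the subspace topology of the product of discrete spaces. -/
def odometerRing (s : ℕ → ℕ) (hs : IsScale s) : Subring (∀ n, ZMod (s n)) where
  carrier := {x | ∀ n, ZMod.castHom (hs.dvd n) (ZMod (s n)) (x (n + 1)) = x n}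
  mul_mem' {a b} ha hb n := by
    simp only [Pi.mul_apply, map_mul, ha n, hb n]
  one_mem' n := by simp only [Pi.one_apply, map_one]
  add_mem' {a b} ha hb n := by
    simp only [Pi.add_apply, map_add, ha n, hb n]
  zero_mem' n := by simp only [Pi.zero_apply, map_zero]
  neg_mem' {a} ha n := by
    simp only [Pi.neg_apply, map_neg, ha n]

/-- The odometer map of scale `s`: the translation `x ↦ x + 1`, where `1 = (1, 1, 1, …)`. -/
def odometerMap (s : ℕ → ℕ) (hs : IsScale s) : odometerRing s hs ≃ₜ odometerRing s hs :=
  Homeomorph.addRight 1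

/-- A system `(X, T)` is an odometer if it is conjugate to the odometer of some scale. -/
def IsOdometer {X : Type*} [TopologicalSpace X] (T : X ≃ₜ X) : Prop :=
  ∃ (s : ℕ → ℕ) (hs : IsScale s), AreConjugate T (odometerMap s hs)

/-!
The proof reconstructs the odometer from the abstract group `G = Aut^(∞)(ℤ_s, x ↦ x + 1)`.

A homeomorphism `φ` commuting with `x ↦ x + n` commutes with translation by every element of the
closure of `nℤ`, and this closure contains some `s_k ℤ_s`. Hence `G` consists of the homeomorphisms
`φ` whose displacement `φ x - x` depends only on `x` modulo some `s_k`
(`exists_constDisplacement`). In particular the support `{x | φ x ≠ x}` is always clopen. On the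
other hand translating a single residue class modulo `s_k` by `s_k` gives elements of `G` of
infinite order with arbitrarily small support, so the action is flexible
(`isFlexibleAction_odometer`).

For flexible actions, a variant of Rubin's argument recovers supports from the group. The relation
`AlgDisjoint f g` is expressed by commutators only; it follows from disjointness of the supports of
`f` and `g`, and implies disjointness of the supports of `f` and `g ^ 12`
(`IsFlexibleAction.algDisjoint`, `IsFlexibleAction.fixed_of_algDisjoint`). Consequently the
centralizer of all `g ^ 12` with `AlgDisjoint f g` is exactly the group of elements supported in the
support of `f` (`IsFlexibleAction.mem_supportSubgroup`), so disjointness of supports, and whether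
finitely many supports cover the space, are properties of the abstract group.

The existence of `f, g ∈ G` such that the sets `gⁱ (supp f)`, `i < d`, partition `ℤ_s` is therefore
an isomorphism invariant of `G`. It holds if `d` divides some `s_k`, with `g` the odometer map and
`f` supported in `d ℤ_s` (`hasCyclicPartition_of_dvd`). Conversely, modulo a suitable `s_k` the
element `g` permutes `ℤ/s_k` and the partition becomes one of `ℤ/s_k` into `d` sets of the same
size, so `d` divides `s_k` (`exists_dvd_of_hasCyclicPartition`). Isomorphic groups thus come from
scales with the same divisors, and for these the reduction maps `ℤ_s → ℤ_t` and `ℤ_t → ℤ_s` are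
inverse conjugacies (`areConjugate_odometerMap`).
-/

open scoped commutatorElement

/-! ### Algebraic disjointness and supports -/

/-- An algebraic substitute for "`f` and `g` have disjoint supports": every `h` that fails to
commute with `f` yields a nontrivial double commutator `⁅f₁, ⁅f₂, h⁆⁆` commuting with `g`, where
`f₁` and `f₂` commute with `g`. -/
def AlgDisjoint {G : Type*} [Group G] (f g : G) : Prop :=
  ∀ h, ¬ Commute f h → ∃ f₁ f₂, Commute f₁ g ∧ Commute f₂ g ∧
    Commute ⁅f₁, ⁅f₂, h⁆⁆ g ∧ ⁅f₁, ⁅f₂, h⁆⁆ ≠ 1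

/-- The centralizer of the twelfth powers of all elements algebraically disjoint from `f`. For the
group actions below it consists of the elements supported in the support of `f`. -/
def supportSubgroup {G : Type*} [Group G] (f : G) : Subgroup G :=
  Subgroup.centralizer {x | ∃ g, AlgDisjoint f g ∧ g ^ 12 = x}

/-- The group-theoretic form of "the space is partitioned into `d` translates, under the powers of
one element `g`, of the support of one element `f`". -/
def HasCyclicPartition (G : Type*) [Group G] (d : ℕ) : Prop :=
  ∃ f g : G,
    (∀ i < d, ∀ j < d, i ≠ j → ∀ m, m ∈ supportSubgroup (g ^ i * f * (g ^ i)⁻¹) →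
      m ∈ supportSubgroup (g ^ j * f * (g ^ j)⁻¹) → m = 1) ∧
    ∀ m, (∀ i < d, ∀ n ∈ supportSubgroup (g ^ i * f * (g ^ i)⁻¹), Commute n m) → m = 1

section Transport

variable {G H : Type*} [Group G] [Group H]

theorem commute_mulEquiv_iff (e : G ≃* H) {a b : G} : Commute (e a) (e b) ↔ Commute a b := by
  simp only [commute_iff_eq, ← map_mul, e.injective.eq_iff]

theorem algDisjoint_mulEquiv_iff (e : G ≃* H) {f g : G} :
    AlgDisjoint (e f) (e g) ↔ AlgDisjoint f g := by
  simp only [AlgDisjoint, e.surjective.forall, e.surjective.exists, ← map_commutatorElement,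
    commute_mulEquiv_iff, ne_eq, map_eq_one_iff e e.injective]

theorem mem_supportSubgroup_iff {f m : G} :
    m ∈ supportSubgroup f ↔ ∀ g, AlgDisjoint f g → Commute (g ^ 12) m := by
  simp [supportSubgroup, Subgroup.mem_centralizer_iff, commute_iff_eq]

theorem mem_supportSubgroup_mulEquiv_iff (e : G ≃* H) {f m : G} :
    e m ∈ supportSubgroup (e f) ↔ m ∈ supportSubgroup f := by
  simp only [mem_supportSubgroup_iff, e.surjective.forall, ← map_pow, commute_mulEquiv_iff,
    algDisjoint_mulEquiv_iff]

theorem HasCyclicPartition.of_mulEquiv (e : G ≃* H) {d : ℕ} (h : HasCyclicPartition G d) :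
    HasCyclicPartition H d := by
  obtain ⟨f, g, hfg⟩ := h
  refine ⟨e f, e g, ?_⟩
  simpa only [e.surjective.forall, ← map_pow, ← map_mul, ← map_inv, commute_mulEquiv_iff,
    mem_supportSubgroup_mulEquiv_iff, map_eq_one_iff e e.injective] using hfg

end Transport

/-! ### Reconstruction of supports -/

/-- An action with clopen supports (that fixed-point sets are closed is automatic on a Hausdorff
space) which is rich in elements of small support: every point `x` of an open set `V` is moved by
the twelfth power of some element supported in `V`. -/
structure IsFlexibleAction (G X : Type*) [Group G] [MulAction G X] [TopologicalSpace X] :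
    Prop where
  isOpen_fixedBy : ∀ g : G, IsOpen (MulAction.fixedBy X g)
  exists_moving : ∀ V : Set X, IsOpen V → ∀ x ∈ V, ∃ g : G, g ^ 12 • x ≠ x ∧ ∀ y ∉ V, g • y = y

section Support

open Topology

variable {G X : Type*} [Group G] [MulAction G X]

theorem smul_ne_of_commute {g m : G} (h : Commute g m) {x : X} (hx : g • x ≠ x) :
    g • m • x ≠ m • x := by
  rwa [← mul_smul, h.eq, mul_smul, (MulAction.injective m).ne_iff]

theorem commute_of_forall_fixed [FaithfulSMul G X] {f g : G}
    (h : ∀ x : X, f • x = x ∨ g • x = x) : Commute f g := by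
  refine FaithfulSMul.eq_of_smul_eq_smul (α := X) fun x => ?_
  rw [mul_smul, mul_smul]
  rcases h x with hf | hg
  · rcases h (g • x) with h' | h'
    · rw [h', hf]
    · rw [MulAction.injective g h', hf, MulAction.injective g h']
  · rcases h (f • x) with h' | h'
    · rw [hg, MulAction.injective f h', hg]
    · rw [h', hg]

theorem smul_pow_eq {g : G} {x : X} (h : g • x = x) (n : ℕ) : g ^ n • x = x := by
  induction n with
  | zero => simp
  | succ n ih => rw [pow_succ, mul_smul, h, ih]

theorem conj_smul_eq_self_iff {f h : G} {x : X} : (h * f * h⁻¹) • x = x ↔ f • h⁻¹ • x = h⁻¹ • x := by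
  rw [mul_smul, mul_smul, smul_eq_iff_eq_inv_smul]

/-- A double commutator `⁅f₁, ⁅f₂, h⁆⁆` with `h` supported in `V` moves only points of the four
sets `c V` with `c ∈ {1, f₁, f₂, f₁ f₂}`. -/
theorem double_commutator_smul_eq {f₁ f₂ h : G} {V : Set X} (hV : ∀ y ∉ V, h • y = y) {y : X}
    (h1 : y ∉ V) (h2 : f₁⁻¹ • y ∉ V) (h3 : f₂⁻¹ • y ∉ V) (h4 : (f₁ * f₂)⁻¹ • y ∉ V) :
    ⁅f₁, ⁅f₂, h⁆⁆ • y = y := by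
  have aux : ∀ z : X, z ∉ V → f₂⁻¹ • z ∉ V → ⁅f₂, h⁆ • z = z := by
    intro z hz hz'
    rw [commutatorElement_def, mul_smul, inv_smul_eq_iff.2 (hV z hz).symm, mul_smul, mul_smul,
      hV _ hz', smul_inv_smul]
  have e1 := aux y h1 h3
  have e2 := aux (f₁⁻¹ • y) h2 (by rwa [mul_inv_rev, mul_smul] at h4)
  rw [commutatorElement_def, mul_smul, inv_smul_eq_iff.2 e1.symm, mul_smul, mul_smul, e2,
    smul_inv_smul]

variable [TopologicalSpace X] [T2Space X]

theorem IsFlexibleAction.exists_not_commute (hG : IsFlexibleAction G X) {V : Set X} (hV : IsOpen V) {x : X}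
    (hx : x ∈ V) : ∃ a b : G, ¬ Commute a b ∧ (∀ y ∉ V, a • y = y) ∧ ∀ y ∉ V, b • y = y := by
  obtain ⟨b, hbx, hb⟩ := hG.exists_moving V hV x hx
  have hbx' : b • x ≠ x := fun h => hbx (smul_pow_eq h 12)
  obtain ⟨a, hax, ha⟩ := hG.exists_moving (V ∩ {b • x}ᶜ) (hV.inter isOpen_compl_singleton) x
    ⟨hx, fun h => hbx' h.symm⟩
  refine ⟨a, b, fun h => ?_, fun y hy => ha y fun h => hy h.1, hb⟩
  exact smul_ne_of_commute h (fun h => hax (smul_pow_eq h 12)) (ha _ fun h => h.2 rfl)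

variable [ContinuousConstSMul G X]

theorem isOpen_moved (g : G) : IsOpen {x : X | g • x ≠ x} :=
  isOpen_ne_fun (continuous_const_smul g) continuous_id

theorem exists_open_forall_smul_notMem {g : G} {x : X} (h : g • x ≠ x) :
    ∃ V : Set X, IsOpen V ∧ x ∈ V ∧ ∀ y ∈ V, g • y ∉ V := by
  obtain ⟨A, B, hA, hB, hxA, hxB, hAB⟩ := t2_separation h
  refine ⟨B ∩ (fun y => g • y) ⁻¹' A, hB.inter (hA.preimage (continuous_const_smul g)),
    ⟨hxB, hxA⟩, fun y hy hy' => ?_⟩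
  exact Set.disjoint_left.1 hAB hy.2 hy'.1

namespace IsFlexibleAction

variable [FaithfulSMul G X]

/-- Elements with disjoint supports are algebraically disjoint: if `h` moves a point of the support
of `f`, then it displaces a neighbourhood `V` of that point, and for `f₁`, `f₂` supported in `V` the
double commutator `⁅f₁, ⁅f₂, h⁆⁆` is just `⁅f₁, f₂⁆`. -/
theorem algDisjoint (hG : IsFlexibleAction G X) {f g : G}
    (hfg : ∀ x : X, f • x = x ∨ g • x = x) : AlgDisjoint f g := by
  intro h hfh
  obtain ⟨x, hfx, hhx⟩ : ∃ x : X, f • x ≠ x ∧ h • x ≠ x := by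
    by_contra! hcon
    exact hfh (commute_of_forall_fixed (X := X) fun x => or_iff_not_imp_left.2 (hcon x))
  obtain ⟨W, hW, hxW, hhW⟩ := exists_open_forall_smul_notMem hhx
  obtain ⟨f₁, f₂, hne, h₁, h₂⟩ :=
    hG.exists_not_commute (hW.inter (isOpen_moved f)) (x := x) ⟨hxW, hfx⟩
  have key : ⁅f₁, ⁅f₂, h⁆⁆ = ⁅f₁, f₂⁆ := by
    have hc : Commute f₁ (h * f₂⁻¹ * h⁻¹) := by
      refine commute_of_forall_fixed (X := X) fun y => or_iff_not_imp_left.2 fun hy => ?_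
      rw [conj_smul_eq_self_iff, inv_smul_eq_iff, eq_comm]
      refine h₂ _ fun hy' => ?_
      have hyW : y ∈ W := by
        by_contra hyW
        exact hy (h₁ y fun h => hyW h.1)
      exact hhW _ hy'.1 (by simpa using hyW)
    have h1 : ⁅f₂, h⁆ = f₂ * (h * f₂⁻¹ * h⁻¹) := by simp [commutatorElement_def, mul_assoc]
    rw [h1]
    generalize h * f₂⁻¹ * h⁻¹ = k at hc
    have h2 : f₁ * k * f₁⁻¹ = k := by rw [hc.eq, mul_inv_cancel_right]
    calc ⁅f₁, f₂ * k⁆ = f₁ * f₂ * f₁⁻¹ * (f₁ * k * f₁⁻¹) * k⁻¹ * f₂⁻¹ := by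
          simp [commutatorElement_def, mul_assoc]
      _ = ⁅f₁, f₂⁆ := by rw [h2]; simp [commutatorElement_def, mul_assoc]
  have hcg : ∀ a : G, (∀ y ∉ W ∩ {x | f • x ≠ x}, a • y = y) → Commute a g := fun a ha =>
    commute_of_forall_fixed (X := X) fun y => by
      rcases hfg y with hy | hy
      · exact Or.inl (ha y fun h => h.2 hy)
      · exact Or.inr hy
  have hc₁ := hcg f₁ h₁
  have hc₂ := hcg f₂ h₂
  refine ⟨f₁, f₂, hc₁, hc₂, ?_, ?_⟩ <;> rw [key]
  · rw [commutatorElement_def]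
    exact ((hc₁.mul_left hc₂).mul_left hc₁.inv_left).mul_left hc₂.inv_left
  · rwa [ne_eq, commutatorElement_eq_one_iff_commute]

/-- Algebraic disjointness of `f` and `g` forces the supports of `f` and `g ^ 12` to be disjoint.
At a common point `x` the points `x, g x, …, g⁴ x` are distinct, as `12 = lcm(1, 2, 3, 4)`; so a
small neighbourhood `V` of `x` is disjoint from `gⁱ V` for `1 ≤ i ≤ 4` and from `f V`. For `h`
supported in `V`, the support of `⁅f₁, ⁅f₂, h⁆⁆` is `g`-invariant and lies in four translates of `V`
by elements commuting with `g`, while each translate meets a `g`-orbit segment of length five in at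
most one point. -/
theorem fixed_of_algDisjoint (hG : IsFlexibleAction G X) {f g : G} (hfg : AlgDisjoint f g) (x : X) :
    f • x = x ∨ g ^ 12 • x = x := by
  by_contra! hx
  obtain ⟨hfx, hgx⟩ := hx
  have hne : ∀ i ∈ Finset.Icc 1 4, g ^ i • x ≠ x := by
    intro i hi h
    have hdvd : i ∣ 12 := by
      have h14 : ∀ k ∈ Finset.Icc 1 4, k ∣ 12 := by decide
      exact h14 i hi
    obtain ⟨m, hm⟩ := hdvd
    apply hgx
    rw [hm, pow_mul]
    exact smul_pow_eq h m
  have hnhds : ∀ a : G, a • x ≠ x → ∀ᶠ V in (𝓝 x).smallSets, ∀ y ∈ V, a • y ∉ V := by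
    intro a ha
    obtain ⟨V, hV, hxV, hVa⟩ := exists_open_forall_smul_notMem ha
    rw [Filter.eventually_smallSets]
    exact ⟨V, hV.mem_nhds hxV, fun t ht y hy hy' => hVa y (ht hy) (ht hy')⟩
  have hall : ∀ᶠ V in (𝓝 x).smallSets, (∀ y ∈ V, f • y ∉ V) ∧
      ∀ i ∈ Finset.Icc 1 4, ∀ y ∈ V, g ^ i • y ∉ V :=
    (hnhds f hfx).and ((Filter.eventually_all_finset _).2 fun i hi => hnhds _ (hne i hi))
  obtain ⟨V₀, hV₀, hall⟩ := Filter.eventually_smallSets.1 hall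
  obtain ⟨V, hVV₀, hV, hxV⟩ := mem_nhds_iff.1 hV₀
  obtain ⟨hfV, hgV⟩ := hall V hVV₀
  obtain ⟨h, hhx, hh⟩ := hG.exists_moving V hV x hxV
  have hhx' : h • x ≠ x := fun h' => hhx (smul_pow_eq h' 12)
  have hnc : ¬ Commute f h := fun hc => smul_ne_of_commute hc.symm hhx' (hh _ (hfV x hxV))
  obtain ⟨f₁, f₂, h₁, h₂, hw, hw1⟩ := hfg h hnc
  obtain ⟨y, hy⟩ : ∃ y : X, ⁅f₁, ⁅f₂, h⁆⁆ • y ≠ y := by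
    by_contra! hcon
    exact hw1 (FaithfulSMul.eq_of_smul_eq_smul (α := X) fun y => by rw [hcon, one_smul])
  have hcov : ∀ a : Fin 5, ∃ c : Fin 4, (![1, f₁, f₂, f₁ * f₂] c)⁻¹ • g ^ (a : ℕ) • y ∈ V := by
    intro a
    by_contra! hcon
    refine smul_ne_of_commute (hw.pow_right (a : ℕ)) hy (double_commutator_smul_eq hh ?_ ?_ ?_ ?_)
    · simpa using hcon 0
    · simpa using hcon 1
    · simpa using hcon 2
    · simpa using hcon 3
  choose c hc using hcov
  obtain ⟨a, b, hab, hcab⟩ : ∃ a b : Fin 5, a < b ∧ c a = c b := by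
    obtain ⟨a, b, hne, heq⟩ := Fintype.exists_ne_map_eq_of_card_lt c (by simp)
    rcases lt_or_gt_of_ne hne with h | h
    · exact ⟨a, b, h, heq⟩
    · exact ⟨b, a, h, heq.symm⟩
  have hcomm : Commute (![1, f₁, f₂, f₁ * f₂] (c b)) g := by
    generalize c b = k
    fin_cases k
    · exact Commute.one_left g
    · exact h₁
    · exact h₂
    · exact h₁.mul_left h₂
  have ha := hc a
  have hb := hc b
  rw [hcab] at ha
  generalize ![1, f₁, f₂, f₁ * f₂] (c b) = k at ha hb hcomm
  have hab' : (a : ℕ) < b := hab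
  refine hgV ((b : ℕ) - a) (by simp; omega) _ ha ?_
  rw [← mul_smul, (hcomm.inv_left.pow_right _).symm.eq, mul_smul, ← mul_smul (g ^ _), ← pow_add,
    Nat.sub_add_cancel hab'.le]
  exact hb

/-- The subgroup attached to `f` in purely algebraic terms is the group of all elements supported in
the support of `f`. -/
theorem mem_supportSubgroup (hG : IsFlexibleAction G X) {f m : G} :
    m ∈ supportSubgroup f ↔ ∀ x : X, f • x = x → m • x = x := by
  rw [mem_supportSubgroup_iff]
  constructor
  · intro h x hfx
    by_contra hmx
    obtain ⟨g, hgx, hg⟩ := hG.exists_moving (MulAction.fixedBy X f ∩ {m • x}ᶜ)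
      ((hG.isOpen_fixedBy f).inter isOpen_compl_singleton) x ⟨hfx, fun h => hmx h.symm⟩
    have hd : AlgDisjoint f g := hG.algDisjoint fun y => by
      by_cases hy : f • y = y
      · exact Or.inl hy
      · exact Or.inr (hg y fun h => hy h.1)
    exact smul_ne_of_commute (h g hd) hgx (smul_pow_eq (hg _ fun h => h.2 rfl) 12)
  · intro h g hd
    refine commute_of_forall_fixed (X := X) fun x => ?_
    rcases hG.fixed_of_algDisjoint hd x with hx | hx
    · exact Or.inr (h x hx)
    · exact Or.inl hx

/-- For a flexible action, disjointness of two supports means that only the identity is supported in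
both, and some supports cover the space exactly when only the identity commutes with everything
supported in one of them. -/
theorem hasCyclicPartition_iff (hG : IsFlexibleAction G X) {d : ℕ} :
    HasCyclicPartition G d ↔ ∃ f g : G,
      (∀ i < d, ∀ j < d, i ≠ j → ∀ x : X,
        (g ^ i * f * (g ^ i)⁻¹) • x = x ∨ (g ^ j * f * (g ^ j)⁻¹) • x = x) ∧
      ∀ x : X, ∃ i < d, (g ^ i * f * (g ^ i)⁻¹) • x ≠ x := by
  refine exists_congr fun f => exists_congr fun g => and_congr ?_ ?_
  · refine forall₂_congr fun i _ => forall₂_congr fun j _ => forall_congr' fun _ => ?_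
    generalize g ^ i * f * (g ^ i)⁻¹ = a
    generalize g ^ j * f * (g ^ j)⁻¹ = b
    simp only [hG.mem_supportSubgroup]
    constructor
    · intro h x
      by_contra! hx
      obtain ⟨m, hmx, hm⟩ :=
        hG.exists_moving _ ((isOpen_moved a).inter (isOpen_moved b)) x hx
      have := h m (fun y hy => hm y fun h => h.1 hy) (fun y hy => hm y fun h => h.2 hy)
      simp [this] at hmx
    · intro h m ha hb
      refine FaithfulSMul.eq_of_smul_eq_smul (α := X) fun x => ?_
      rw [one_smul]
      exact (h x).elim (ha x) (hb x)
  · simp only [hG.mem_supportSubgroup]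
    constructor
    · intro h x
      by_contra! hx
      have hopen : IsOpen (⋂ i ∈ Finset.range d, MulAction.fixedBy X (g ^ i * f * (g ^ i)⁻¹)) :=
        isOpen_biInter_finset fun i _ => hG.isOpen_fixedBy _
      obtain ⟨m, hmx, hm⟩ := hG.exists_moving _ hopen x (by simpa using hx)
      have : m = 1 := h m fun i hi n hn => commute_of_forall_fixed (X := X) fun y => by
        by_cases hy : (g ^ i * f * (g ^ i)⁻¹) • y = y
        · exact Or.inl (hn y hy)
        · exact Or.inr (hm y fun h => hy (Set.mem_iInter₂.1 h i (Finset.mem_range.2 hi)))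
      simp [this] at hmx
    · intro h m hm
      refine FaithfulSMul.eq_of_smul_eq_smul (α := X) fun x => ?_
      rw [one_smul]
      by_contra hmx
      obtain ⟨i, hi, hx⟩ := h x
      obtain ⟨n, hnx, hn⟩ := hG.exists_moving _
        ((isOpen_moved (g ^ i * f * (g ^ i)⁻¹)).inter (isOpen_compl_singleton (x := m • x))) x
        ⟨hx, fun h => hmx h.symm⟩
      refine smul_ne_of_commute (hm i hi n fun y hy => hn y fun h => h.1 hy)
        (fun h => hnx (smul_pow_eq h 12)) (hn _ fun h => h.2 rfl)

end IsFlexibleAction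

end Support

/-! ### Odometers and bump homeomorphisms -/

section Odometer

variable {X : Type*} [TopologicalSpace X]

instance (T : X ≃ₜ X) : MulAction (stabilizedAutGroup T) X where
  smul φ x := (φ : X ≃ₜ X) x
  one_smul _ := rfl
  mul_smul _ _ _ := rfl

theorem stabilizedAutGroup_smul_def {T : X ≃ₜ X} (φ : stabilizedAutGroup T) (x : X) :
    φ • x = (φ : X ≃ₜ X) x := rfl

instance (T : X ≃ₜ X) : FaithfulSMul (stabilizedAutGroup T) X where
  eq_of_smul_eq_smul h := Subtype.ext (Homeomorph.ext h)

instance (T : X ≃ₜ X) : ContinuousConstSMul (stabilizedAutGroup T) X where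
  continuous_const_smul φ := (φ : X ≃ₜ X).continuous

variable {s : ℕ → ℕ} {hs : IsScale s}

theorem IsScale.dvd_of_le (hs : IsScale s) {k l : ℕ} (h : k ≤ l) : s k ∣ s l :=
  Nat.le_induction dvd_rfl (fun n _ ih => ih.trans (hs.dvd n)) l h

theorem castHom_castHom_zmod {a b c : ℕ} (hab : a ∣ b) (hbc : b ∣ c) (x : ZMod c) :
    ZMod.castHom hab (ZMod a) (ZMod.castHom hbc (ZMod b) x) =
      ZMod.castHom (hab.trans hbc) (ZMod a) x :=
  RingHom.congr_fun (Subsingleton.elim ((ZMod.castHom hab (ZMod a)).comp _) _) x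

namespace odometerRing

/-- The ring homomorphism `ℤ_s → ℤ/s_k`. -/
def proj (hs : IsScale s) (k : ℕ) : odometerRing s hs →+* ZMod (s k) :=
  (Pi.evalRingHom (fun n => ZMod (s n)) k).comp (odometerRing s hs).subtype

theorem continuous_proj (k : ℕ) : Continuous (proj hs k) :=
  (continuous_apply k).comp continuous_subtype_val

theorem ext_proj {x y : odometerRing s hs} (h : ∀ k, proj hs k x = proj hs k y) : x = y :=
  Subtype.ext (funext h)

theorem castHom_proj (x : odometerRing s hs) {k l : ℕ} (h : k ≤ l) :
    ZMod.castHom (hs.dvd_of_le h) (ZMod (s k)) (proj hs l x) = proj hs k x := by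
  induction l, h using Nat.le_induction with
  | base => simp
  | succ l hkl ih =>
    rw [← ih, ← show ZMod.castHom (hs.dvd l) (ZMod (s l)) (proj hs (l + 1) x) = proj hs l x from
      x.2 l, castHom_castHom_zmod]

theorem proj_eq_of_le {x y : odometerRing s hs} {k l : ℕ} (hkl : k ≤ l)
    (h : proj hs l x = proj hs l y) : proj hs k x = proj hs k y := by
  rw [← castHom_proj x hkl, ← castHom_proj y hkl, h]

/-- The sets `{y | y ≡ x mod s_k}` form a neighbourhood basis of `x`. -/
theorem exists_proj_subset {V : Set (odometerRing s hs)} (hV : IsOpen V) {x : odometerRing s hs}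
    (hx : x ∈ V) (k₀ : ℕ) : ∃ k ≥ k₀, ∀ y, proj hs k y = proj hs k x → y ∈ V := by
  obtain ⟨U, hU, rfl⟩ := isOpen_induced_iff.1 hV
  obtain ⟨I, u, hu, hIU⟩ := isOpen_pi_iff.1 hU x.1 hx
  refine ⟨k₀ + I.sup id, Nat.le_add_right _ _, fun y hy => hIU fun i hi => ?_⟩
  have hik : i ≤ k₀ + I.sup id := (Finset.le_sup (f := id) hi).trans (Nat.le_add_left _ _)
  have : y.1 i = x.1 i := proj_eq_of_le hik hy
  rw [this]
  exact (hu i hi).2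

theorem natCast_ne_zero {n : ℕ} (hn : 0 < n) : (n : odometerRing s hs) ≠ 0 := by
  intro h
  obtain ⟨k, hk⟩ := hs.unbounded n
  have h1 : ((n : ℕ) : ZMod (s k)) = 0 := by simpa using congrArg (proj hs k) h
  exact absurd (Nat.le_of_dvd hn ((ZMod.natCast_eq_zero_iff _ _).1 h1)) (not_le.2 hk)

end odometerRing

open odometerRing

theorem odometerMap_apply (x : odometerRing s hs) : odometerMap s hs x = x + 1 := rfl

theorem odometerMap_pow_apply (n : ℕ) (x : odometerRing s hs) :
    (odometerMap s hs ^ n) x = x + n := by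
  induction n with
  | zero => simp
  | succ n ih =>
    rw [pow_succ', Homeomorph.mul_apply, ih, odometerMap_apply, Nat.cast_succ, add_assoc]

/-- The homeomorphism of `ℤ_s` translating by `s_k` the points whose residue modulo `s_k` lies in
`A`, and fixing all other points. -/
noncomputable def bumpHomeomorph (hs : IsScale s) (k : ℕ) (A : Set (ZMod (s k))) :
    odometerRing s hs ≃ₜ odometerRing s hs where
  toFun x := x + A.indicator (fun _ => (s k : odometerRing s hs)) (proj hs k x)
  invFun x := x - A.indicator (fun _ => (s k : odometerRing s hs)) (proj hs k x)
  left_inv x := by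
    have : ∀ x, proj hs k (x + A.indicator (fun _ => (s k : odometerRing s hs)) (proj hs k x))
        = proj hs k x := fun x => by
      by_cases h : proj hs k x ∈ A <;> simp [h]
    simp only [this, add_sub_cancel_right]
  right_inv x := by
    have : ∀ x, proj hs k (x - A.indicator (fun _ => (s k : odometerRing s hs)) (proj hs k x))
        = proj hs k x := fun x => by
      by_cases h : proj hs k x ∈ A <;> simp [h]
    simp only [this, sub_add_cancel]
  continuous_toFun := continuous_id.add <| (continuous_of_discreteTopology
    (f := A.indicator fun _ : ZMod (s k) => (s k : odometerRing s hs))).comp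
      (continuous_proj k)
  continuous_invFun := continuous_id.sub <| (continuous_of_discreteTopology
    (f := A.indicator fun _ : ZMod (s k) => (s k : odometerRing s hs))).comp
      (continuous_proj k)

theorem bumpHomeomorph_apply (k : ℕ) (A : Set (ZMod (s k))) (x : odometerRing s hs) :
    bumpHomeomorph hs k A x =
      x + A.indicator (fun _ => (s k : odometerRing s hs)) (proj hs k x) := rfl

theorem bumpHomeomorph_mem (k : ℕ) (A : Set (ZMod (s k))) :
    bumpHomeomorph hs k A ∈ stabilizedAutGroup (odometerMap s hs) := by
  refine ⟨s k, hs.pos k, Homeomorph.ext fun x => ?_⟩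
  have hx : proj hs k (x + s k) = proj hs k x := by simp
  simp only [Homeomorph.mul_apply, odometerMap_pow_apply, bumpHomeomorph_apply]
  rw [hx, add_right_comm]

/-- `bumpHomeomorph` as an element of the stabilized automorphism group. -/
noncomputable def bump (hs : IsScale s) (k : ℕ) (A : Set (ZMod (s k))) :
    stabilizedAutGroup (odometerMap s hs) :=
  ⟨bumpHomeomorph hs k A, bumpHomeomorph_mem k A⟩

theorem bump_smul_of_notMem {k : ℕ} {A : Set (ZMod (s k))} {x : odometerRing s hs}
    (h : proj hs k x ∉ A) : bump hs k A • x = x := by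
  simp [stabilizedAutGroup_smul_def, bump, bumpHomeomorph_apply, h]

theorem bump_pow_smul_of_mem {k : ℕ} {A : Set (ZMod (s k))} {x : odometerRing s hs}
    (h : proj hs k x ∈ A) (n : ℕ) : bump hs k A ^ n • x = x + (n * s k : ℕ) := by
  induction n with
  | zero => simp
  | succ n ih =>
    rw [pow_succ', mul_smul, ih, stabilizedAutGroup_smul_def, bump, bumpHomeomorph_apply,
      Set.indicator_of_mem (by simpa using h)]
    push_cast
    ring

theorem bump_smul_eq_self_iff {k : ℕ} {A : Set (ZMod (s k))} {x : odometerRing s hs} :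
    bump hs k A • x = x ↔ proj hs k x ∉ A := by
  refine ⟨fun h hA => ?_, bump_smul_of_notMem⟩
  have := bump_pow_smul_of_mem hA 1
  rw [pow_one, h, left_eq_add, one_mul] at this
  exact natCast_ne_zero (hs.pos k) this

/-! ### Displacements are locally constant -/

/-- The displacement `φ x - x` depends only on the residue of `x` modulo `s_k`. -/
def ConstDisplacement (hs : IsScale s) (k : ℕ) (φ : stabilizedAutGroup (odometerMap s hs)) : Prop :=
  ∀ x y, proj hs k x = proj hs k y → φ • x - x = φ • y - y

theorem ConstDisplacement.mono {k l : ℕ} (hkl : k ≤ l) {φ : stabilizedAutGroup (odometerMap s hs)}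
    (h : ConstDisplacement hs k φ) : ConstDisplacement hs l φ :=
  fun x y hxy => h x y (proj_eq_of_le hkl hxy)

theorem ConstDisplacement.proj_smul_eq {k : ℕ} {φ : stabilizedAutGroup (odometerMap s hs)}
    (h : ConstDisplacement hs k φ) {x y : odometerRing s hs} (hxy : proj hs k x = proj hs k y) :
    proj hs k (φ • x) = proj hs k (φ • y) := by
  have := congrArg (proj hs k) (h x y hxy)
  rwa [map_sub, map_sub, hxy, sub_left_inj] at this

theorem constDisplacement_one (k : ℕ) :
    ConstDisplacement hs k (1 : stabilizedAutGroup (odometerMap s hs)) := fun x y _ => by simp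

theorem ConstDisplacement.mul {k : ℕ} {φ ψ : stabilizedAutGroup (odometerMap s hs)}
    (hφ : ConstDisplacement hs k φ) (hψ : ConstDisplacement hs k ψ) :
    ConstDisplacement hs k (φ * ψ) := fun x y hxy => by
  have h1 := hφ _ _ (hψ.proj_smul_eq hxy)
  have h2 := hψ x y hxy
  rw [mul_smul, mul_smul]
  linear_combination h1 + h2

theorem ConstDisplacement.pow {k : ℕ} {φ : stabilizedAutGroup (odometerMap s hs)}
    (hφ : ConstDisplacement hs k φ) (n : ℕ) : ConstDisplacement hs k (φ ^ n) := by
  induction n with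
  | zero => simpa using constDisplacement_one k
  | succ n ih => rw [pow_succ]; exact ih.mul hφ

/-- For fixed `n ≥ 1` the divisors `gcd(n, s_l)` stabilize, so that some `s_k` generates a smaller
ideal than `n` does in every `ℤ/s_l`. -/
theorem exists_gcd_dvd (hs : IsScale s) {n : ℕ} (hn : 1 ≤ n) : ∃ k, ∀ l, Nat.gcd n (s l) ∣ s k := by
  have hmono : Monotone fun l => Nat.gcd n (s l) := fun a b hab =>
    Nat.le_of_dvd (Nat.gcd_pos_of_pos_left _ hn) (Nat.gcd_dvd_gcd_of_dvd_right _ (hs.dvd_of_le hab))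
  have hfin : (Set.range fun l => Nat.gcd n (s l)).Finite :=
    (Set.finite_Iic n).subset (by rintro _ ⟨l, rfl⟩; exact Nat.gcd_le_left _ hn)
  obtain ⟨_, ⟨k, rfl⟩, hk⟩ := hfin.exists_maximal (Set.range_nonempty _)
  refine ⟨k, fun l => ?_⟩
  have h1 : Nat.gcd n (s (max k l)) = Nat.gcd n (s k) :=
    le_antisymm (hk ⟨_, rfl⟩ (hmono (le_max_left k l))) (hmono (le_max_left k l))
  calc Nat.gcd n (s l) ∣ Nat.gcd n (s (max k l)) :=
        Nat.gcd_dvd_gcd_of_dvd_right _ (hs.dvd_of_le (le_max_right k l))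
    _ ∣ s k := h1 ▸ Nat.gcd_dvd_right _ _

/-- An element of `Aut(ℤ_s, T ^ n)` has a continuous displacement invariant under translation by
`n`, hence under translation by the closure of `nℤ`, which contains some `s_k ℤ_s`. -/
theorem exists_constDisplacement (φ : stabilizedAutGroup (odometerMap s hs)) :
    ∃ k, ConstDisplacement hs k φ := by
  obtain ⟨φ, n, hn, hφ⟩ := φ
  obtain ⟨k, hk⟩ := exists_gcd_dvd hs hn
  refine ⟨k, fun x y hxy => ?_⟩
  simp only [stabilizedAutGroup_smul_def]
  have hstep : ∀ z, φ (z + n) = φ z + n := fun z => by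
    simpa only [Homeomorph.mul_apply, odometerMap_pow_apply] using
      DFunLike.congr_fun (show φ * odometerMap s hs ^ n = odometerMap s hs ^ n * φ from hφ) z
  have hinv : ∀ j : ℕ, φ (x + (j * n : ℕ)) - (x + (j * n : ℕ)) = φ x - x := by
    intro j
    induction j with
    | zero => simp
    | succ j ih =>
      rw [Nat.succ_mul, Nat.cast_add, ← add_assoc, hstep, ← ih]
      ring
  have hclosed : IsClosed {z | φ x - x = φ z - z} :=
    isClosed_eq continuous_const (φ.continuous.sub continuous_id)
  by_contra hy
  obtain ⟨l, hlk, hl⟩ := exists_proj_subset hclosed.isOpen_compl (x := y) hy k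
  -- Solve `j n = y - x` in `ℤ/s_l`, using that `y - x` vanishes modulo `s_k`.
  obtain ⟨c, hc⟩ : ∃ c : ℕ, (c * Nat.gcd n (s l) : ℕ) = proj hs l (y - x) := by
    have : NeZero (s l) := ⟨(hs.pos l).ne'⟩
    have h0 : ((proj hs l (y - x)).val : ZMod (s k)) = 0 := by
      have := castHom_proj (y - x) hlk
      rwa [map_sub (proj hs k), hxy, sub_self, ZMod.castHom_apply, ZMod.cast_eq_val] at this
    obtain ⟨c, hc⟩ := (hk l).trans ((ZMod.natCast_eq_zero_iff _ _).1 h0)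
    exact ⟨c, by rw [mul_comm, ← hc, ZMod.natCast_zmod_val]⟩
  obtain ⟨j, hj⟩ : ∃ j : ℕ, ((j * n : ℕ) : ZMod (s l)) = Nat.gcd n (s l) := by
    have : NeZero (s l) := ⟨(hs.pos l).ne'⟩
    refine ⟨(Nat.gcdA n (s l) : ZMod (s l)).val, ?_⟩
    have := congrArg (Int.cast : ℤ → ZMod (s l)) (Nat.gcd_eq_gcd_ab n (s l))
    push_cast at this
    rw [this]
    simp [mul_comm]
  refine hl (x + ((c * j) * n : ℕ)) ?_ (hinv (c * j)).symm
  rw [map_add, map_natCast, mul_assoc, Nat.cast_mul, hj, ← Nat.cast_mul, hc, map_sub]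
  ring

theorem exists_constDisplacement_finset (F : Finset (stabilizedAutGroup (odometerMap s hs))) :
    ∃ k, ∀ φ ∈ F, ConstDisplacement hs k φ := by
  choose κ hκ using exists_constDisplacement (hs := hs)
  exact ⟨F.sup κ, fun φ hφ => (hκ φ).mono (Finset.le_sup hφ)⟩

/-! ### Divisors of the scale are encoded in the group -/

theorem isFlexibleAction_odometer (hs : IsScale s) :
    IsFlexibleAction (stabilizedAutGroup (odometerMap s hs)) (odometerRing s hs) where
  isOpen_fixedBy φ := by
    obtain ⟨k, hk⟩ := exists_constDisplacement φ
    have : MulAction.fixedBy (odometerRing s hs) φ =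
        proj hs k ⁻¹' (proj hs k '' MulAction.fixedBy (odometerRing s hs) φ) := by
      refine (Set.subset_preimage_image _ _).antisymm ?_
      rintro x ⟨y, hy, hyx⟩
      have h1 := hk y x hyx
      rw [MulAction.mem_fixedBy] at hy ⊢
      rwa [hy, sub_self, eq_comm, sub_eq_zero] at h1
    rw [this]
    exact (isOpen_discrete _).preimage (continuous_proj k)
  exists_moving V hV x hx := by
    obtain ⟨k, -, hk⟩ := exists_proj_subset hV hx 0
    refine ⟨bump hs k {proj hs k x}, ?_, fun y hy => bump_smul_of_notMem fun h => hy (hk y h)⟩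
    rw [bump_pow_smul_of_mem (Set.mem_singleton _), ne_eq, add_eq_left]
    exact natCast_ne_zero (Nat.mul_pos (by norm_num) (hs.pos k))

theorem hasCyclicPartition_of_dvd {d k : ℕ} (hd : d ∣ s k) :
    HasCyclicPartition (stabilizedAutGroup (odometerMap s hs)) d := by
  have hdpos : 0 < d := Nat.pos_of_dvd_of_pos hd (hs.pos k)
  have : NeZero d := ⟨hdpos.ne'⟩
  let r : odometerRing s hs →+* ZMod d := (ZMod.castHom hd (ZMod d)).comp (proj hs k)
  let T : stabilizedAutGroup (odometerMap s hs) := ⟨odometerMap s hs, 1, le_rfl, by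
    rw [pow_one]; exact rfl⟩
  have hT : ∀ (i : ℕ) (x : odometerRing s hs), T ^ i • x = x + i := fun i x =>
    odometerMap_pow_apply i x
  have hTinv : ∀ (i : ℕ) (x : odometerRing s hs), (T ^ i)⁻¹ • x = x - i := fun i x => by
    rw [inv_smul_eq_iff, hT, sub_add_cancel]
  -- The conjugate by `T ^ i` of the bump over the multiples of `d` is supported in `i + d ℤ_s`.
  have key : ∀ (i : ℕ) (x : odometerRing s hs),
      (T ^ i * bump hs k {a | ZMod.castHom hd (ZMod d) a = 0} * (T ^ i)⁻¹) • x = x ↔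
        r x ≠ i := by
    intro i x
    rw [conj_smul_eq_self_iff, bump_smul_eq_self_iff, hTinv, Set.mem_ofPred_eq, not_iff_not,
      ← RingHom.comp_apply, map_sub, map_natCast, sub_eq_zero]
  refine (isFlexibleAction_odometer hs).hasCyclicPartition_iff.2
    ⟨bump hs k {a | ZMod.castHom hd (ZMod d) a = 0}, T, ?_, ?_⟩
  · intro i hi j hj hij x
    rw [key, key]
    by_contra! h
    have h1 : (i : ZMod d) = j := h.1.symm.trans h.2
    rw [ZMod.natCast_eq_natCast_iff', Nat.mod_eq_of_lt hi, Nat.mod_eq_of_lt hj] at h1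
    exact hij h1
  · intro x
    refine ⟨(r x).val, ZMod.val_lt _, ?_⟩
    rw [ne_eq, key, ZMod.natCast_zmod_val]
    simp

/-- If `d` translates of a clopen set partition `ℤ_s`, then for large `k` the corresponding sets of
residues modulo `s_k` partition `ℤ/s_k` and have equal cardinalities. -/
theorem exists_dvd_of_hasCyclicPartition {d : ℕ}
    (h : HasCyclicPartition (stabilizedAutGroup (odometerMap s hs)) d) : ∃ k, d ∣ s k := by
  obtain ⟨f, g, hdisj, hcov⟩ := (isFlexibleAction_odometer hs).hasCyclicPartition_iff.1 h
  classical
  obtain ⟨k, hk⟩ := exists_constDisplacement_finset (hs := hs) {f, g, g⁻¹}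
  have hf : ConstDisplacement hs k f := hk f (by simp)
  have hg : ConstDisplacement hs k g := hk g (by simp)
  have hg' : ConstDisplacement hs k g⁻¹ := hk g⁻¹ (by simp)
  refine ⟨k, ?_⟩
  have : NeZero (s k) := ⟨(hs.pos k).ne'⟩
  let lift : ZMod (s k) → odometerRing s hs := fun a => (a.val : odometerRing s hs)
  have hlift : ∀ a, proj hs k (lift a) = a := fun a => by simp [lift]
  let A : ℕ → Finset (ZMod (s k)) := fun i =>
    Finset.univ.filter fun a => (g ^ i * f * (g ^ i)⁻¹) • lift a ≠ lift a
  have hA : ∀ i x, proj hs k x ∈ A i ↔ (g ^ i * f * (g ^ i)⁻¹) • x ≠ x := by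
    intro i x
    have hi : ConstDisplacement hs k (g ^ i * f * (g ^ i)⁻¹) := by
      rw [← inv_pow]
      exact ((hg.pow i).mul hf).mul (hg'.pow i)
    simp only [A, Finset.mem_filter, Finset.mem_univ, true_and, ne_eq, not_iff_not]
    rw [← sub_eq_zero, hi _ x (hlift _), sub_eq_zero]
  have hcard : ∀ i, (A i).card = (A 0).card := by
    intro i
    refine Finset.card_bij' (fun a _ => proj hs k ((g ^ i)⁻¹ • lift a))
      (fun a _ => proj hs k (g ^ i • lift a)) ?_ ?_ ?_ ?_
    · intro a ha
      rw [← hlift a, hA, ne_eq, conj_smul_eq_self_iff] at ha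
      simpa [hA] using ha
    · intro a ha
      rw [← hlift a, hA] at ha
      rw [hA, ne_eq, conj_smul_eq_self_iff, inv_smul_smul]
      simpa using ha
    · intro a _
      rw [(hg.pow i).proj_smul_eq (hlift _), smul_inv_smul, hlift]
    · intro a _
      have hgi : ConstDisplacement hs k (g ^ i)⁻¹ := by
        rw [← inv_pow]
        exact hg'.pow i
      rw [hgi.proj_smul_eq (hlift _), inv_smul_smul, hlift]
  have hunion : (Finset.range d).biUnion A = Finset.univ := by
    refine Finset.eq_univ_of_forall fun a => ?_
    obtain ⟨i, hi, hia⟩ := hcov (lift a)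
    exact Finset.mem_biUnion.2 ⟨i, Finset.mem_range.2 hi, by rw [← hlift a, hA]; exact hia⟩
  have hsum : s k = ∑ i ∈ Finset.range d, (A i).card := by
    rw [← Finset.card_biUnion, hunion, Finset.card_univ, ZMod.card]
    intro i hi j hj hij
    refine Finset.disjoint_left.2 fun a hai haj => ?_
    rw [← hlift a, hA] at hai haj
    exact (hdisj i (by simpa using hi) j (by simpa using hj) hij (lift a)).elim hai haj
  rw [hsum, Finset.sum_congr rfl fun i _ => hcard i, Finset.sum_const, Finset.card_range]
  exact Dvd.intro _ rfl

end Odometer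

/-! ### Odometers whose scales have the same divisors are conjugate -/

section Conjugacy

open odometerRing

variable {s t : ℕ → ℕ} {hs : IsScale s} {ht : IsScale t}

theorem odometerRing.castHom_proj_congr (x : odometerRing s hs) {m k l : ℕ} (hk : m ∣ s k)
    (hl : m ∣ s l) : ZMod.castHom hk (ZMod m) (proj hs k x) =
      ZMod.castHom hl (ZMod m) (proj hs l x) := by
  wlog hkl : k ≤ l generalizing k l
  · exact (this hl hk (le_of_not_ge hkl)).symm
  rw [← castHom_proj x hkl, castHom_castHom_zmod]

/-- The map `ℤ_s → ℤ_t` given by reduction of residues, when every `t_n` divides some `s_k`. -/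
noncomputable def odometerReduction (hs : IsScale s) (ht : IsScale t)
    (h : ∀ n, ∃ k, t n ∣ s k) (x : odometerRing s hs) : odometerRing t ht :=
  ⟨fun n => ZMod.castHom (h n).choose_spec (ZMod (t n)) (proj hs (h n).choose x), fun n => by
    rw [castHom_castHom_zmod]
    exact castHom_proj_congr x _ _⟩

theorem proj_odometerReduction (h : ∀ n, ∃ k, t n ∣ s k) (x : odometerRing s hs) {n k : ℕ}
    (hk : t n ∣ s k) : proj ht n (odometerReduction hs ht h x) =
      ZMod.castHom hk (ZMod (t n)) (proj hs k x) :=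
  castHom_proj_congr x (h n).choose_spec hk

theorem continuous_odometerReduction (h : ∀ n, ∃ k, t n ∣ s k) :
    Continuous (odometerReduction hs ht h) :=
  Continuous.subtype_mk (continuous_pi fun _ =>
    continuous_of_discreteTopology.comp (continuous_proj _)) _

theorem odometerReduction_add_one (h : ∀ n, ∃ k, t n ∣ s k) (x : odometerRing s hs) :
    odometerReduction hs ht h (x + 1) = odometerReduction hs ht h x + 1 :=
  ext_proj fun n => by
    obtain ⟨k, hk⟩ := h n
    simp only [map_add, map_one, proj_odometerReduction h _ hk]

theorem odometerReduction_odometerReduction (h : ∀ n, ∃ k, t n ∣ s k) (h' : ∀ n, ∃ k, s n ∣ t k)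
    (x : odometerRing s hs) : odometerReduction ht hs h' (odometerReduction hs ht h x) = x :=
  ext_proj fun n => by
    obtain ⟨j, hj⟩ := h' n
    obtain ⟨k, hk⟩ := h j
    rw [proj_odometerReduction h' _ hj, proj_odometerReduction h _ hk, castHom_castHom_zmod,
      castHom_proj_congr x (hj.trans hk) dvd_rfl]
    simp

theorem areConjugate_odometerMap (h : ∀ n, ∃ k, t n ∣ s k) (h' : ∀ n, ∃ k, s n ∣ t k) :
    AreConjugate (odometerMap s hs) (odometerMap t ht) :=
  ⟨{ toFun := odometerReduction hs ht h
     invFun := odometerReduction ht hs h'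
     left_inv := odometerReduction_odometerReduction h h'
     right_inv := odometerReduction_odometerReduction h' h
     continuous_toFun := continuous_odometerReduction h
     continuous_invFun := continuous_odometerReduction h' }, odometerReduction_add_one h⟩

end Conjugacy

/-! ### Conjugate systems have isomorphic stabilized automorphism groups -/

section AreConjugate

variable {X Y Z : Type*} [TopologicalSpace X] [TopologicalSpace Y] [TopologicalSpace Z]
  {T : X ≃ₜ X} {S : Y ≃ₜ Y} {R : Z ≃ₜ Z}

theorem AreConjugate.symm (h : AreConjugate T S) : AreConjugate S T := by
  obtain ⟨π, hπ⟩ := h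
  exact ⟨π.symm, fun y => by rw [Homeomorph.symm_apply_eq, hπ, Homeomorph.apply_symm_apply]⟩

theorem AreConjugate.trans (h : AreConjugate T S) (h' : AreConjugate S R) : AreConjugate T R := by
  obtain ⟨π, hπ⟩ := h
  obtain ⟨ρ, hρ⟩ := h'
  exact ⟨π.trans ρ, fun x => by simp [hπ, hρ]⟩

/-- Conjugation by a homeomorphism, as an isomorphism of homeomorphism groups. -/
def homeomorphConj (π : X ≃ₜ Y) : (X ≃ₜ X) ≃* (Y ≃ₜ Y) where
  toFun φ := (π.symm.trans φ).trans π
  invFun ψ := (π.trans ψ).trans π.symm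
  left_inv φ := by ext x; simp
  right_inv ψ := by ext y; simp
  map_mul' φ ψ := by ext y; simp

theorem AreConjugate.nonempty_mulEquiv (h : AreConjugate T S) :
    Nonempty (stabilizedAutGroup T ≃* stabilizedAutGroup S) := by
  obtain ⟨π, hπ⟩ := h
  let c := homeomorphConj π
  have hc : c T = S := by
    ext y
    simp [c, homeomorphConj, hπ]
  refine ⟨(c.subgroupMap (stabilizedAutGroup T)).trans (MulEquiv.subgroupCongr ?_)⟩
  ext ψ
  obtain ⟨φ, rfl⟩ := c.surjective ψ
  refine (Subgroup.mem_map_iff_mem (f := c.toMonoidHom) c.injective).trans ?_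
  refine exists_congr fun n => and_congr_right fun _ => ?_
  change φ * T ^ n = T ^ n * φ ↔ c φ * S ^ n = S ^ n * c φ
  rw [← hc, ← map_pow, ← map_mul, ← map_mul, c.injective.eq_iff]

end AreConjugate

/-! ### Reconstruction of the odometer -/

theorem mainTheorem9 {X Y : Type*} [MetricSpace X] [CompactSpace X]
    [MetricSpace Y] [CompactSpace Y] (T : X ≃ₜ X) (S : Y ≃ₜ Y)
    (hT : IsOdometer T) (hS : IsOdometer S)
    (h : Nonempty (stabilizedAutGroup T ≃* stabilizedAutGroup S)) :
    AreConjugate T S := by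
  obtain ⟨s, hs, hTs⟩ := hT
  obtain ⟨t, ht, hSt⟩ := hS
  obtain ⟨e⟩ := h
  obtain ⟨a⟩ := hTs.nonempty_mulEquiv
  obtain ⟨b⟩ := hSt.nonempty_mulEquiv
  let E : stabilizedAutGroup (odometerMap s hs) ≃* stabilizedAutGroup (odometerMap t ht) :=
    (a.symm.trans e).trans b
  refine hTs.trans (.trans (areConjugate_odometerMap (fun n => ?_) fun n => ?_) hSt.symm)
  · exact exists_dvd_of_hasCyclicPartition
      ((hasCyclicPartition_of_dvd (hs := ht) (dvd_refl (t n))).of_mulEquiv E.symm)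
  · exact exists_dvd_of_hasCyclicPartition
      ((hasCyclicPartition_of_dvd (hs := hs) (dvd_refl (s n))).of_mulEquiv E)
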